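/- Let $d\ge 1$, $L>0$, let $\theta:[0,1]\to\mathbb S^{d-1}\subset\mathbb R^d$ be a $C^1$ path on the Euclidean unit sphere (one-sided derivatives at $0$ and $1$), and let $\gamma:[0,1]\to\mathbb R^d$ be a path with $\dot\gamma(t)=L\,\theta(t)$ for all $t\in[0,1]$ (so $\gamma$ has constant speed $L$ and length $L$). For $x\in\mathbb R^d$ put $F(x)=\begin{pmatrix}0&x\\x^{T}&0\end{pmatrix}\in\mathbb R^{(d+1)\times(d+1)}$, and let $o=(0,\dots,0,1)^T\in\mathbb R^{d+1}$. For $\lambda>0$ let $\Gamma_\lambda:[0,1]\to\mathbb R^{(d+1)\times(d+1)}$ be the Cartan development of the rescaled path $\lambda\gamma$, i.e. the solution of $$\Gamma_\lambda'(t)=F(\lambda\dot\gamma(t))\,\Gamma_\lambda(t),\qquad \Gamma_\lambda(0)=\mathrm{id},$$ and let $(\rho_\lambda,\eta_\lambda)$, with $\rho_\lambda(t)\ge 0$ and $\eta_\lambda(t)\in\mathbb S^{d-1}$, be the polar coordinates of the hyperbolic development $\Gamma_\lambda(t)o$ of $\lambda\gamma$, i.e. $$\Gamma_\lambda(t)\,o=\begin{pmatrix}\eta_\lambda(t)\sinh\rho_\lambda(t)\\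 \cosh\rho_\lambda(t)\end{pmatrix},\qquad t\in[0,1]$$ (if $\Gamma_\lambda(t)o=o$, then $\rho_\lambda(t)=0$ and $\eta_\lambda(t)$ is an arbitrary unit vector). Such $\Gamma_\lambda,\rho_\lambda,\eta_\lambda$ exist for every $\lambda>0$, and for any choice of them and every $t\in(0,1]$, $$\lim_{\lambda\to+\infty}\lambda L\,\bigl(\eta_\lambda(t)-\theta(t)\bigr)=-\bigl(I+\theta(t)\theta(t)^{T}\bigr)^{-1}\theta'(t),$$ where $I$ is the $d\times d$ identity matrix. In particular $\eta_\lambda(1)\to\theta(1)$ as $\lambda\to+\infty$. -/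

import Mathlib

open Set Filter Topology

noncomputable section

/-- The linear map `F` from `ℝ^d` to the Lie algebra of the isometry group of hyperbolic space,
`F x = [[0, x], [xᵀ, 0]]`; the index `Sum.inr ()` is the last, time-like coordinate
of `ℝ^(d+1)`. -/
def hypGen {d : ℕ} (x : EuclideanSpace ℝ (Fin d)) :
    Matrix (Fin d ⊕ Unit) (Fin d ⊕ Unit) ℝ :=
  Matrix.fromBlocks 0 (Matrix.replicateCol Unit x.ofLp) (Matrix.replicateRow Unit x.ofLp) 0

/-- The base point `o = (0, …, 0, 1)` of the hyperboloid. -/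
def hypBase (d : ℕ) : Fin d ⊕ Unit → ℝ :=
  Sum.elim (fun _ => 0) (fun _ => 1)

/-- The point `(η sinh ρ, cosh ρ)` of `ℝ^(d+1)`. -/
def hypPolar {d : ℕ} (η : EuclideanSpace ℝ (Fin d)) (ρ : ℝ) : Fin d ⊕ Unit → ℝ :=
  Sum.elim (fun i => η i * Real.sinh ρ) (fun _ => Real.cosh ρ)

/-- `Γ` is the Cartan development of the differentiable path `γ : [0,1] → ℝ^d`: it solves the
linear differential equation `dΓ(u) = F(dγ(u)) Γ(u)` on `[0,1]`, entry by entry, with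
`Γ(0) = id`. Values of `γ` and `Γ` outside `[0,1]` play no role. -/
structure IsCartanDevelopment {d : ℕ} (γ : ℝ → EuclideanSpace ℝ (Fin d))
    (Γ : ℝ → Matrix (Fin d ⊕ Unit) (Fin d ⊕ Unit) ℝ) : Prop where
  differentiable : DifferentiableOn ℝ γ (Icc 0 1)
  init : Γ 0 = 1
  ode : ∀ u ∈ Icc (0 : ℝ) 1, ∀ i j,
    HasDerivWithinAt (fun v => Γ v i j)
      ((hypGen (derivWithin γ (Icc 0 1) u) * Γ u) i j) (Icc 0 1) u

/-- `(η, ρ)` are polar coordinates, with `η(t)` in the unit sphere and `ρ(t) ≥ 0`, of the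
development `t ↦ Γ(t) o` of `γ` on the hyperboloid:
`Γ(t) o = (η(t) sinh ρ(t), cosh ρ(t))`. At times with `Γ(t) o = o`, such as `t = 0`, one has
`ρ(t) = 0` and the unit vector `η(t)` is arbitrary. -/
def IsHyperbolicDevelopment {d : ℕ} (γ : ℝ → EuclideanSpace ℝ (Fin d))
    (η : ℝ → EuclideanSpace ℝ (Fin d)) (ρ : ℝ → ℝ) : Prop :=
  ∃ Γ : ℝ → Matrix (Fin d ⊕ Unit) (Fin d ⊕ Unit) ℝ,
    IsCartanDevelopment γ Γ ∧
    ∀ t ∈ Icc (0 : ℝ) 1,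
      ‖η t‖ = 1 ∧ 0 ≤ ρ t ∧ Matrix.mulVec (Γ t) (hypBase d) = hypPolar (η t) (ρ t)

end

/-!
Let `(x, y)` be the column `Γ(t) o` of the development and `α = λ L` the speed. It solves
`x' = α y θ`, `y' = α ⟨θ, x⟩` and stays on the upper sheet of `y² - |x|² = 1`. Let `C` bound `|θ'|`,
assume `C < α`, and use the moving frame along `θ`: the expanding light-cone coordinate
`q = y + ⟨θ, x⟩`, the contracting one `p = y - ⟨θ, x⟩`, and the transverse part
`x^⊥ = x - ⟨θ, x⟩ θ`.

The bound `|x| ≤ y` makes `⟨θ, x⟩` increasing, so `y ≤ q ≤ 2 y`, and `q' ≥ (α - C) q`. Comparing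
derivatives with `q` gives `|x^⊥| ≤ 2 C q / (α - C)` (`norm_transverse_le`), and then
`p q = 1 + |x^⊥|²` makes `p / q` of order `α⁻²` at positive times. To find the transverse part to
first order, fix `t` and put `h(s) = x^⊥(s) + (y(s) / α) θ'(t)`. Then
`h' = ⟨θ, x⟩ (θ'(t) - θ'(s)) - ⟨θ', x^⊥⟩ θ`, which is small near `t`, while the exponential growth
of `q` makes the rest of the interval negligible: `α h(t) / q(t) → 0`
(`norm_transverse_add_le`). Only continuity of `θ'` is needed here. Since
`α (η - θ) + θ'(t)` is `α h / y - (α p / y) θ` up to `α (1 - tanh ρ) η`, this gives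
`α (η - θ) → -θ'(t)` (`tendsto_smul_polar_direction_sub`). Finally `θ' ⟂ θ`, and `I + θ θᵀ` is the
identity on the orthogonal complement of `θ`.

Existence of the development is that of solutions of linear equations on the whole interval
(`exists_linear_ode_solution`); polar coordinates exist since the curve stays on the upper sheet.
-/

/-! ### Differential inequalities and linear equations on an interval -/

/-- One-sided derivatives within `[a, b]` are right derivatives at the points of `[a, b)`. -/
theorem HasDerivWithinAt.Ici_of_Icc {E : Type*} [NormedAddCommGroup E] [NormedSpace ℝ E]
    {f : ℝ → E} {f' : E} {a b s : ℝ} (hs : s ∈ Ico a b)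
    (hf : HasDerivWithinAt f f' (Icc a b) s) : HasDerivWithinAt f f' (Ici s) s :=
  hf.mono_of_mem_nhdsWithin (Icc_mem_nhdsGE_of_mem hs)

theorem norm_le_of_norm_derivWithin_le_Icc {E : Type*} [NormedAddCommGroup E] [NormedSpace ℝ E]
    {f f' : ℝ → E} {B B' : ℝ → ℝ} {a b : ℝ}
    (hf : ∀ s ∈ Icc a b, HasDerivWithinAt f (f' s) (Icc a b) s)
    (hB : ∀ s ∈ Icc a b, HasDerivWithinAt B (B' s) (Icc a b) s)
    (ha : ‖f a‖ ≤ B a) (bound : ∀ s ∈ Icc a b, ‖f' s‖ ≤ B' s) {s : ℝ} (hs : s ∈ Icc a b) :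
    ‖f s‖ ≤ B s :=
  image_norm_le_of_norm_deriv_right_le_deriv_boundary'
    (fun s hs => (hf s hs).continuousWithinAt)
    (fun s hs => (hf s (Ico_subset_Icc_self hs)).Ici_of_Icc hs) ha
    (fun s hs => (hB s hs).continuousWithinAt)
    (fun s hs => (hB s (Ico_subset_Icc_self hs)).Ici_of_Icc hs)
    (fun s hs => bound s (Ico_subset_Icc_self hs)) hs

theorem le_of_derivWithin_le_Icc {f f' B B' : ℝ → ℝ} {a b : ℝ}
    (hf : ∀ s ∈ Icc a b, HasDerivWithinAt f (f' s) (Icc a b) s)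
    (hB : ∀ s ∈ Icc a b, HasDerivWithinAt B (B' s) (Icc a b) s)
    (ha : f a ≤ B a) (bound : ∀ s ∈ Icc a b, f' s ≤ B' s) {s : ℝ} (hs : s ∈ Icc a b) :
    f s ≤ B s :=
  image_le_of_deriv_right_le_deriv_boundary
    (fun s hs => (hf s hs).continuousWithinAt)
    (fun s hs => (hf s (Ico_subset_Icc_self hs)).Ici_of_Icc hs) ha
    (fun s hs => (hB s hs).continuousWithinAt)
    (fun s hs => (hB s (Ico_subset_Icc_self hs)).Ici_of_Icc hs)
    (fun s hs => bound s (Ico_subset_Icc_self hs)) hs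

/-- Coordinatewise truncation of a vector to the cube `[-R, R]^ι`. -/
def cubeClamp {ι : Type*} (R : ℝ) (w : ι → ℝ) : ι → ℝ := fun i => max (-R) (min R (w i))

theorem abs_clamp_le {R r : ℝ} (hR : 0 ≤ R) : |max (-R) (min R r)| ≤ R :=
  abs_le.2 ⟨le_max_left _ _, max_le (by linarith) (min_le_left _ _)⟩

theorem abs_clamp_le_abs {R r : ℝ} (hR : 0 ≤ R) : |max (-R) (min R r)| ≤ |r| := by
  rcases max_cases (-R) (min R r) with h | h <;> rcases min_cases R r with h' | h' <;>
    rw [abs_le] <;> constructor <;> cases abs_cases r <;> linarith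

theorem lipschitzWith_cubeClamp {ι : Type*} [Fintype ι] (R : ℝ) :
    LipschitzWith 1 (cubeClamp R : (ι → ℝ) → ι → ℝ) := by
  refine LipschitzWith.of_dist_le_mul fun v w => ?_
  rw [NNReal.coe_one, one_mul]
  refine (dist_pi_le_iff dist_nonneg).2 fun i => le_trans ?_ (dist_le_pi_dist v w i)
  have h := ((LipschitzWith.id (α := ℝ)).const_min R).const_max (-R)
  simpa [cubeClamp] using h.dist_le_mul (v i) (w i)

theorem norm_cubeClamp_le {ι : Type*} [Fintype ι] {R : ℝ} (hR : 0 ≤ R) (w : ι → ℝ) :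
    ‖cubeClamp R w‖ ≤ R :=
  (pi_norm_le_iff_of_nonneg hR).2 fun _ => abs_clamp_le hR

theorem norm_cubeClamp_le_norm {ι : Type*} [Fintype ι] {R : ℝ} (hR : 0 ≤ R) (w : ι → ℝ) :
    ‖cubeClamp R w‖ ≤ ‖w‖ :=
  (pi_norm_le_iff_of_nonneg (norm_nonneg w)).2 fun i =>
    (abs_clamp_le_abs hR).trans (norm_le_pi_norm w i)

theorem cubeClamp_eq_self {ι : Type*} [Fintype ι] {R : ℝ} {w : ι → ℝ} (hw : ‖w‖ ≤ R) :
    cubeClamp R w = w := by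
  funext i
  have h := abs_le.1 ((norm_le_pi_norm w i).trans hw)
  simp [cubeClamp, h.1, h.2]

/-- Linear equations with continuous coefficients are solvable on all of `[0, 1]`. Truncating the
unknown to a large cube makes the vector field bounded, so that the Picard-Lindelöf theorem applies
on the whole interval; by Grönwall's inequality the solution never leaves the cube. -/
theorem exists_linear_ode_solution {ι : Type*} [Fintype ι] {A : ℝ → (ι → ℝ) →L[ℝ] (ι → ℝ)}
    (hA : ContinuousOn A (Icc 0 1)) (w : ι → ℝ) :
    ∃ z : ℝ → ι → ℝ, z 0 = w ∧
      ∀ t ∈ Icc (0 : ℝ) 1, HasDerivWithinAt z (A t (z t)) (Icc 0 1) t := by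
  obtain ⟨K₀, hK₀⟩ := isCompact_Icc.exists_bound_of_continuousOn hA
  obtain ⟨K, hK⟩ : ∃ K : NNReal, ∀ t ∈ Icc (0 : ℝ) 1, ‖A t‖ ≤ K :=
    ⟨K₀.toNNReal, fun t ht => (hK₀ t ht).trans (Real.le_coe_toNNReal _)⟩
  obtain ⟨R, hR⟩ : ∃ R : NNReal, (R : ℝ) = ‖w‖ * Real.exp K :=
    ⟨⟨‖w‖ * Real.exp K, by positivity⟩, rfl⟩
  have hpl : IsPicardLindelof (fun t z => A t (cubeClamp R z))
      (⟨0, by simp⟩ : Icc (0 : ℝ) 1) w (K * R) 0 (K * R) K := by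
    refine ⟨fun t ht => ?_, fun z _ => ?_, fun t ht z _ => ?_, by simp⟩
    · have h := ((A t).lipschitz.comp (lipschitzWith_cubeClamp (ι := ι) R)).weaken
        (K' := K) (by rw [mul_one, ← NNReal.coe_le_coe]; exact hK t ht)
      exact h.lipschitzOnWith
    · exact hA.clm_apply continuousOn_const
    · calc ‖A t (cubeClamp R z)‖ ≤ ‖A t‖ * ‖cubeClamp R z‖ := (A t).le_opNorm _
        _ ≤ K * R := mul_le_mul (hK t ht) (norm_cubeClamp_le R.2 z) (norm_nonneg _) K.2
  obtain ⟨z, hz0, hz⟩ := hpl.exists_eq_forall_mem_Icc_hasDerivWithinAt₀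
  simp only at hz0
  have hbound : ∀ t ∈ Icc (0 : ℝ) 1, ‖z t‖ ≤ R := by
    intro t ht
    have h := norm_le_gronwallBound_of_norm_deriv_right_le (δ := ‖w‖) (K := K) (ε := 0)
      (fun s hs => (hz s hs).continuousWithinAt)
      (fun s hs => (hz s (Ico_subset_Icc_self hs)).Ici_of_Icc hs) (by rw [hz0])
      (fun s hs => by
        rw [add_zero]
        exact ((A s).le_opNorm _).trans (mul_le_mul (hK s (Ico_subset_Icc_self hs))
          (norm_cubeClamp_le_norm R.2 _) (norm_nonneg _) K.2)) t ht
    rw [gronwallBound_ε0] at h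
    refine h.trans ?_
    rw [hR]
    gcongr
    simpa using mul_le_mul_of_nonneg_left ht.2 K.2
  refine ⟨z, hz0, fun t ht => ?_⟩
  simpa only [cubeClamp_eq_self (hbound t ht)] using hz t ht

open scoped RealInnerProductSpace

/-! ### Quantitative asymptotics of the development -/

/-- The first-order system satisfied by the column `Γ(t) o = (x(t), y(t))` of a Cartan development,
driven at speed `α` by a path `θ` on the unit sphere with derivative `θ'`. -/
structure IsHyperboloidCurve {E : Type*} [NormedAddCommGroup E] [InnerProductSpace ℝ E]
    (α : ℝ) (θ θ' x : ℝ → E) (y : ℝ → ℝ) : Prop where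
  deriv_dir : ∀ s ∈ Icc (0 : ℝ) 1, HasDerivWithinAt θ (θ' s) (Icc 0 1) s
  norm_dir : ∀ s ∈ Icc (0 : ℝ) 1, ‖θ s‖ = 1
  deriv_space : ∀ s ∈ Icc (0 : ℝ) 1, HasDerivWithinAt x ((α * y s) • θ s) (Icc 0 1) s
  deriv_time : ∀ s ∈ Icc (0 : ℝ) 1, HasDerivWithinAt y (α * ⟪θ s, x s⟫) (Icc 0 1) s
  space_zero : x 0 = 0
  time_zero : y 0 = 1

namespace IsHyperboloidCurve

variable {E : Type*} [NormedAddCommGroup E] [InnerProductSpace ℝ E]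
  {α C : ℝ} {θ θ' x : ℝ → E} {y : ℝ → ℝ}

/-- The curve stays on the hyperboloid `y² - |x|² = 1`. -/
theorem time_sq (h : IsHyperboloidCurve α θ θ' x y) {s : ℝ} (hs : s ∈ Icc (0 : ℝ) 1) :
    y s ^ 2 = 1 + ‖x s‖ ^ 2 := by
  have key := norm_le_of_norm_derivWithin_le_Icc (f := fun s => y s ^ 2 - ‖x s‖ ^ 2 - 1)
    (f' := fun _ => 0) (B := fun _ => 0) (B' := fun _ => 0) (fun s hs => ?_)
    (fun s _ => hasDerivWithinAt_const ..) (by simp [h.space_zero, h.time_zero]) (by simp) hs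
  · have := norm_le_zero_iff.1 key
    linarith
  · refine ((((h.deriv_time s hs).pow 2).sub (h.deriv_space s hs).norm_sq).sub_const
      1).congr_deriv ?_
    rw [inner_smul_right, real_inner_comm (θ s)]
    push_cast
    ring

/-- The curve stays on the upper sheet of the hyperboloid, by the intermediate value theorem. -/
theorem one_le_time (h : IsHyperboloidCurve α θ θ' x y) {s : ℝ} (hs : s ∈ Icc (0 : ℝ) 1) :
    1 ≤ y s := by
  have hsq := h.time_sq hs
  have hpos : 0 ≤ y s := by
    by_contra! hneg
    have hsub : Icc 0 s ⊆ Icc (0 : ℝ) 1 := Icc_subset_Icc_right hs.2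
    obtain ⟨u, hu, hu0⟩ := intermediate_value_Icc' hs.1
      (fun u hu => ((h.deriv_time u (hsub hu)).continuousWithinAt.mono hsub))
      ⟨hneg.le, h.time_zero ▸ zero_le_one⟩
    have := h.time_sq (hsub hu)
    rw [hu0] at this
    nlinarith [sq_nonneg ‖x u‖]
  nlinarith [sq_nonneg ‖x s‖]

theorem norm_space_le (h : IsHyperboloidCurve α θ θ' x y) {s : ℝ} (hs : s ∈ Icc (0 : ℝ) 1) :
    ‖x s‖ ≤ y s :=
  abs_le_of_sq_le_sq' (by linarith [h.time_sq hs]) (by linarith [h.one_le_time hs]) |>.2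

theorem inner_dir_self (h : IsHyperboloidCurve α θ θ' x y) {s : ℝ} (hs : s ∈ Icc (0 : ℝ) 1) :
    ⟪θ s, θ s⟫ = 1 := by
  rw [real_inner_self_eq_norm_sq, h.norm_dir s hs, one_pow]

theorem abs_inner_deriv_space_le (h : IsHyperboloidCurve α θ θ' x y)
    (hC : ∀ s ∈ Icc (0 : ℝ) 1, ‖θ' s‖ ≤ C) {s : ℝ} (hs : s ∈ Icc (0 : ℝ) 1) :
    |⟪θ' s, x s⟫| ≤ C * y s :=
  (abs_real_inner_le_norm _ _).trans <|
    mul_le_mul (hC s hs) (h.norm_space_le hs) (norm_nonneg _) ((norm_nonneg _).trans (hC s hs))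

theorem hasDerivWithinAt_inner (h : IsHyperboloidCurve α θ θ' x y) {s : ℝ}
    (hs : s ∈ Icc (0 : ℝ) 1) :
    HasDerivWithinAt (fun s => ⟪θ s, x s⟫) (α * y s + ⟪θ' s, x s⟫) (Icc 0 1) s := by
  refine ((h.deriv_dir s hs).inner ℝ (h.deriv_space s hs)).congr_deriv ?_
  rw [inner_smul_right, h.inner_dir_self hs, mul_one]

/-- The component of `x` along `θ` is increasing as soon as `α` exceeds the speed of `θ`. -/
theorem inner_nonneg (h : IsHyperboloidCurve α θ θ' x y)
    (hC : ∀ s ∈ Icc (0 : ℝ) 1, ‖θ' s‖ ≤ C) (hα : C < α) {s : ℝ} (hs : s ∈ Icc (0 : ℝ) 1) :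
    0 ≤ ⟪θ s, x s⟫ := by
  refine le_of_derivWithin_le_Icc (f := fun _ => 0) (f' := fun _ => 0)
    (fun s _ => hasDerivWithinAt_const ..) (fun s hs => h.hasDerivWithinAt_inner hs)
    (by simp [h.space_zero]) (fun s hs => ?_) hs
  have h1 := (abs_le.1 (h.abs_inner_deriv_space_le hC hs)).1
  have h2 := mul_pos (sub_pos.2 hα) (zero_lt_one.trans_le (h.one_le_time hs))
  linarith

theorem inner_le_time (h : IsHyperboloidCurve α θ θ' x y) {s : ℝ} (hs : s ∈ Icc (0 : ℝ) 1) :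
    ⟪θ s, x s⟫ ≤ y s := by
  have := real_inner_le_norm (θ s) (x s)
  rw [h.norm_dir s hs, one_mul] at this
  exact this.trans (h.norm_space_le hs)

/-- The expanding light-cone coordinate `y + ⟨θ, x⟩`. -/
def expanding (θ x : ℝ → E) (y : ℝ → ℝ) (s : ℝ) : ℝ := y s + ⟪θ s, x s⟫

/-- The component of `x` orthogonal to `θ`. -/
def transverse (θ x : ℝ → E) (s : ℝ) : E := x s - ⟪θ s, x s⟫ • θ s

theorem hasDerivWithinAt_expanding (h : IsHyperboloidCurve α θ θ' x y) {s : ℝ}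
    (hs : s ∈ Icc (0 : ℝ) 1) :
    HasDerivWithinAt (expanding θ x y) (α * expanding θ x y s + ⟪θ' s, x s⟫) (Icc 0 1) s := by
  refine ((h.deriv_time s hs).add (h.hasDerivWithinAt_inner hs)).congr_deriv ?_
  rw [expanding]; ring

theorem time_le_expanding (h : IsHyperboloidCurve α θ θ' x y)
    (hC : ∀ s ∈ Icc (0 : ℝ) 1, ‖θ' s‖ ≤ C) (hα : C < α) {s : ℝ} (hs : s ∈ Icc (0 : ℝ) 1) :
    y s ≤ expanding θ x y s := by
  have := h.inner_nonneg hC hα hs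
  rw [expanding]; linarith

theorem expanding_le_two_mul_time (h : IsHyperboloidCurve α θ θ' x y) {s : ℝ}
    (hs : s ∈ Icc (0 : ℝ) 1) : expanding θ x y s ≤ 2 * y s := by
  have := h.inner_le_time hs
  rw [expanding]; linarith

theorem mul_expanding_le_deriv (h : IsHyperboloidCurve α θ θ' x y)
    (hC : ∀ s ∈ Icc (0 : ℝ) 1, ‖θ' s‖ ≤ C) (hα : C < α) {s : ℝ} (hs : s ∈ Icc (0 : ℝ) 1) :
    (α - C) * expanding θ x y s ≤ α * expanding θ x y s + ⟪θ' s, x s⟫ := by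
  have h1 := (abs_le.1 (h.abs_inner_deriv_space_le hC hs)).1
  have h2 := mul_le_mul_of_nonneg_left (h.time_le_expanding hC hα hs)
    ((norm_nonneg _).trans (hC s hs))
  linarith

theorem one_le_expanding (h : IsHyperboloidCurve α θ θ' x y)
    (hC : ∀ s ∈ Icc (0 : ℝ) 1, ‖θ' s‖ ≤ C) (hα : C < α) {s : ℝ} (hs : s ∈ Icc (0 : ℝ) 1) :
    1 ≤ expanding θ x y s :=
  (h.one_le_time hs).trans (h.time_le_expanding hC hα hs)

theorem mul_le_expanding (h : IsHyperboloidCurve α θ θ' x y)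
    (hC : ∀ s ∈ Icc (0 : ℝ) 1, ‖θ' s‖ ≤ C) (hα : C < α) {s : ℝ} (hs : s ∈ Icc (0 : ℝ) 1) :
    (α - C) * s ≤ expanding θ x y s := by
  refine le_of_derivWithin_le_Icc (f := fun s => (α - C) * s) (f' := fun _ => α - C)
    (fun s _ => by simpa using (hasDerivWithinAt_id s (Icc (0 : ℝ) 1)).const_mul (α - C))
    (fun s hs => h.hasDerivWithinAt_expanding hs) ?_ (fun s hs => ?_) hs
  · have := h.one_le_expanding hC hα (s := 0) (by simp)
    simp only [mul_zero]; linarith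
  · refine le_trans ?_ (h.mul_expanding_le_deriv hC hα hs)
    exact le_mul_of_one_le_right (sub_pos.2 hα).le (h.one_le_expanding hC hα hs)

/-- The terms of order `α` cancel in the derivative of the transverse component. -/
theorem hasDerivWithinAt_transverse (h : IsHyperboloidCurve α θ θ' x y) {s : ℝ}
    (hs : s ∈ Icc (0 : ℝ) 1) :
    HasDerivWithinAt (transverse θ x) (-(⟪θ s, x s⟫ • θ' s) - ⟪θ' s, x s⟫ • θ s) (Icc 0 1) s := by
  refine ((h.deriv_space s hs).sub
    ((h.hasDerivWithinAt_inner hs).smul (h.deriv_dir s hs))).congr_deriv ?_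
  module

theorem norm_transverse_le (h : IsHyperboloidCurve α θ θ' x y)
    (hC : ∀ s ∈ Icc (0 : ℝ) 1, ‖θ' s‖ ≤ C) (hα : C < α) {s : ℝ} (hs : s ∈ Icc (0 : ℝ) 1) :
    ‖transverse θ x s‖ ≤ 2 * C / (α - C) * expanding θ x y s := by
  have hC0 : 0 ≤ C := (norm_nonneg _).trans (hC s hs)
  have hβ := sub_pos.2 hα
  refine norm_le_of_norm_derivWithin_le_Icc (fun s hs => h.hasDerivWithinAt_transverse hs)
    (fun s hs => (h.hasDerivWithinAt_expanding hs).const_mul _) ?_ (fun s hs => ?_) hs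
  · have := h.one_le_expanding hC hα (s := 0) (by simp)
    simp only [transverse, h.space_zero, inner_zero_right, zero_smul, sub_zero, norm_zero]
    positivity
  · calc ‖-(⟪θ s, x s⟫ • θ' s) - ⟪θ' s, x s⟫ • θ s‖
        ≤ ‖⟪θ s, x s⟫ • θ' s‖ + ‖⟪θ' s, x s⟫ • θ s‖ := by
          simpa using norm_sub_le (-(⟪θ s, x s⟫ • θ' s)) (⟪θ' s, x s⟫ • θ s)
      _ ≤ y s * C + C * y s := by
          rw [norm_smul, norm_smul, h.norm_dir s hs, mul_one, Real.norm_eq_abs, Real.norm_eq_abs,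
            abs_of_nonneg (h.inner_nonneg hC hα hs)]
          have hy := h.one_le_time hs
          exact add_le_add (mul_le_mul (h.inner_le_time hs) (hC s hs) (norm_nonneg _)
            (by linarith)) (h.abs_inner_deriv_space_le hC hs)
      _ ≤ 2 * C * expanding θ x y s := by
          have := mul_le_mul_of_nonneg_left (h.time_le_expanding hC hα hs) hC0
          linarith
      _ = 2 * C / (α - C) * ((α - C) * expanding θ x y s) := by field_simp
      _ ≤ _ := mul_le_mul_of_nonneg_left (h.mul_expanding_le_deriv hC hα hs) (by positivity)

/-- In light-cone coordinates the hyperboloid is `(y - ⟨θ, x⟩) (y + ⟨θ, x⟩) = 1 + |x^⊥|²`. -/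
theorem contracting_mul_expanding (h : IsHyperboloidCurve α θ θ' x y) {s : ℝ}
    (hs : s ∈ Icc (0 : ℝ) 1) :
    (y s - ⟪θ s, x s⟫) * expanding θ x y s = 1 + ‖transverse θ x s‖ ^ 2 := by
  rw [transverse, norm_sub_sq_real, norm_smul, h.norm_dir s hs, mul_one, inner_smul_right,
    real_inner_comm (θ s) (x s), Real.norm_eq_abs, sq_abs, expanding]
  linarith [h.time_sq hs]

theorem contracting_nonneg (h : IsHyperboloidCurve α θ θ' x y) {s : ℝ} (hs : s ∈ Icc (0 : ℝ) 1) :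
    0 ≤ y s - ⟪θ s, x s⟫ := sub_nonneg.2 (h.inner_le_time hs)

theorem inner_deriv_transverse (h : IsHyperboloidCurve α θ θ' x y) {s : ℝ}
    (hs : s ∈ Icc (0 : ℝ) 1) : ⟪θ s, θ' s⟫ = 0 ∧ ⟪θ' s, transverse θ x s⟫ = ⟪θ' s, x s⟫ := by
  have h0 : ⟪θ s, θ' s⟫ = 0 := by
    have h1 := (h.deriv_dir s hs).inner ℝ (h.deriv_dir s hs)
    have h2 : HasDerivWithinAt (fun s => ⟪θ s, θ s⟫) 0 (Icc 0 1) s :=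
      (hasDerivWithinAt_const s (Icc (0 : ℝ) 1) (1 : ℝ)).congr_of_mem
        (fun u hu => h.inner_dir_self hu) hs
    have h3 := (uniqueDiffOn_Icc zero_lt_one s hs).eq_deriv _ h1 h2
    rw [real_inner_comm (θ s) (θ' s)] at h3
    linarith
  refine ⟨h0, ?_⟩
  rw [transverse, inner_sub_right, inner_smul_right, real_inner_comm (θ s), h0]
  ring

/-- The transverse component follows `-(y / α) θ'(t)` up to an error governed by the modulus of
continuity of `θ'` at `t`. The affine majorant `ε + M (t - s)` of that modulus is integrated against
the exponentially growing weight `y + ⟨θ, x⟩`, which turns `M (t - s)` into `M / (α - C)`. -/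
theorem norm_transverse_add_le (h : IsHyperboloidCurve α θ θ' x y)
    (hC : ∀ s ∈ Icc (0 : ℝ) 1, ‖θ' s‖ ≤ C) (hα : C < α) {t ε M : ℝ} (ht : t ∈ Icc (0 : ℝ) 1)
    (hε : 0 ≤ ε) (hM : 0 ≤ M)
    (hmod : ∀ s ∈ Icc 0 t, ‖θ' t - θ' s‖ ≤ ε + M * (t - s)) :
    ‖transverse θ x t + (y t / α) • θ' t‖ ≤
      C / α + (ε + (2 * C ^ 2 + M) / (α - C)) / (α - C) * expanding θ x y t := by
  have hC0 : 0 ≤ C := (norm_nonneg _).trans (hC t ht)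
  have hβ := sub_pos.2 hα
  have hα0 : 0 < α := by linarith
  have hsub : Icc 0 t ⊆ Icc (0 : ℝ) 1 := Icc_subset_Icc_right ht.2
  set β := α - C with hβdef
  set q := expanding θ x y with hq
  have key := norm_le_of_norm_derivWithin_le_Icc (a := 0) (b := t) (s := t)
    (f := fun s => transverse θ x s + (y s / α) • θ' t)
    (f' := fun s => ⟪θ s, x s⟫ • (θ' t - θ' s) - ⟪θ' s, transverse θ x s⟫ • θ s)
    (B := fun s => C / α + (ε + (2 * C ^ 2 + M) / β + M * (t - s)) / β * q s)
    (B' := fun s => -M / β * q s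
      + (ε + (2 * C ^ 2 + M) / β + M * (t - s)) / β * (α * q s + ⟪θ' s, x s⟫))
    ?_ ?_ ?_ ?_ ⟨ht.1, le_rfl⟩
  · simpa using key
  · intro s hs
    have hs' := hsub hs
    refine HasDerivWithinAt.mono ?_ hsub
    refine ((h.hasDerivWithinAt_transverse hs').add
      (((h.deriv_time s hs').div_const α).smul_const (θ' t))).congr_deriv ?_
    rw [(h.inner_deriv_transverse hs').2, mul_div_cancel_left₀ _ hα0.ne']
    module
  · intro s hs
    have hs' := hsub hs
    refine HasDerivWithinAt.mono ?_ hsub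
    have h1 : HasDerivWithinAt (fun s => (ε + (2 * C ^ 2 + M) / β + M * (t - s)) / β) (-M / β)
        (Icc 0 1) s := by
      have := ((((hasDerivAt_id s).const_sub t).const_mul M).const_add
        (ε + (2 * C ^ 2 + M) / β)).div_const β
      simpa using this.hasDerivWithinAt
    exact (h1.mul (h.hasDerivWithinAt_expanding hs')).const_add _
  · have hq0 := h.one_le_expanding hC hα (s := 0) (by simp)
    rw [← hq] at hq0
    have h1 : ‖transverse θ x 0 + (y 0 / α) • θ' t‖ ≤ C / α := by
      simp only [transverse, h.space_zero, h.time_zero, inner_zero_right, zero_smul, sub_zero,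
        zero_add, norm_smul, norm_div, norm_one, Real.norm_eq_abs, abs_of_pos hα0]
      rw [one_div, ← div_eq_inv_mul]
      exact div_le_div_of_nonneg_right (hC t ht) hα0.le
    refine h1.trans (le_add_of_nonneg_right ?_)
    have := ht.1
    simp only [sub_zero]
    positivity
  · intro s hs
    have hs' := hsub hs
    have hq1 := h.one_le_expanding hC hα hs'
    have hyq := h.time_le_expanding hC hα hs'
    have hderiv := h.mul_expanding_le_deriv hC hα hs'
    have htr := h.norm_transverse_le hC hα hs'
    rw [← hq] at hq1 hyq hderiv htr
    have hts : 0 ≤ t - s := sub_nonneg.2 hs.2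
    calc ‖⟪θ s, x s⟫ • (θ' t - θ' s) - ⟪θ' s, transverse θ x s⟫ • θ s‖
        ≤ ‖⟪θ s, x s⟫ • (θ' t - θ' s)‖ + ‖⟪θ' s, transverse θ x s⟫ • θ s‖ := norm_sub_le _ _
      _ ≤ q s * (ε + M * (t - s)) + C * (2 * C / β * q s) := by
          rw [norm_smul, norm_smul, h.norm_dir s hs', mul_one, Real.norm_eq_abs,
            Real.norm_eq_abs, abs_of_nonneg (h.inner_nonneg hC hα hs')]
          refine add_le_add (mul_le_mul ((h.inner_le_time hs').trans hyq) (hmod s hs)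
            (norm_nonneg _) (by linarith)) ?_
          exact (abs_real_inner_le_norm _ _).trans
            (mul_le_mul (hC s hs') htr (norm_nonneg _) hC0)
      _ = -M / β * q s + (ε + (2 * C ^ 2 + M) / β + M * (t - s)) / β * (β * q s) := by
          field_simp; ring
      _ ≤ _ := by gcongr

/-! ### Convergence of the polar direction -/

/-- Decomposition of the polar direction: the three error terms come from replacing the unit sphere
by the Klein model `x / y`, from the transverse component, and from the contracting light-cone
coordinate. -/
theorem norm_polar_direction_le (h : IsHyperboloidCurve α θ θ' x y) (hα : 0 < α) {t ρ : ℝ}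
    (ht : t ∈ Icc (0 : ℝ) 1) {η : E} (hη : ‖η‖ = 1) (hρ : 0 ≤ ρ) (hx : x t = Real.sinh ρ • η)
    (hy : y t = Real.cosh ρ) :
    ‖α • (η - θ t) + θ' t‖ ≤ α / y t ^ 2 + α / y t * ‖transverse θ x t + (y t / α) • θ' t‖
      + α / y t * (y t - ⟪θ t, x t⟫) := by
  have hy0 : 0 < y t := zero_lt_one.trans_le (h.one_le_time ht)
  have hp := h.contracting_nonneg ht
  have hsinh : 0 ≤ Real.sinh ρ := Real.sinh_nonneg_iff.2 hρ
  have hident : Real.cosh ρ ^ 2 - Real.sinh ρ ^ 2 = 1 := Real.cosh_sq_sub_sinh_sq ρ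
  rw [← hy] at hident
  have hsy : Real.sinh ρ ≤ y t := hy ▸ (Real.sinh_lt_cosh ρ).le
  have hdecomp : α • (η - θ t) + θ' t = (α * (1 - Real.sinh ρ / y t)) • η
      + (α / y t) • (transverse θ x t + (y t / α) • θ' t)
      - (α / y t * (y t - ⟪θ t, x t⟫)) • θ t := by
    rw [transverse]
    generalize ⟪θ t, x t⟫ = A
    rw [hx]
    match_scalars <;> field_simp <;> ring
  -- The Klein-model error is `1 - tanh ρ ≤ 1 / cosh² ρ`.
  have h1 : α * (1 - Real.sinh ρ / y t) ≤ α / y t ^ 2 := by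
    rw [div_eq_mul_one_div α]
    refine mul_le_mul_of_nonneg_left ?_ hα.le
    rw [one_sub_div hy0.ne', div_le_div_iff₀ hy0 (by positivity)]
    nlinarith [mul_nonneg hy0.le (mul_nonneg (sub_nonneg.2 hsy) hsinh)]
  have h0 : 0 ≤ α * (1 - Real.sinh ρ / y t) :=
    mul_nonneg hα.le (sub_nonneg.2 ((div_le_one hy0).2 hsy))
  rw [hdecomp]
  refine (norm_sub_le _ _).trans (add_le_add ((norm_add_le _ _).trans (add_le_add ?_ ?_)) ?_)
  · rwa [norm_smul, hη, mul_one, Real.norm_eq_abs, abs_of_nonneg h0]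
  · rw [norm_smul, Real.norm_eq_abs, abs_of_nonneg (by positivity)]
  · rw [norm_smul, h.norm_dir t ht, mul_one, Real.norm_eq_abs, abs_of_nonneg (by positivity)]

/-- The total error in terms of `α`, `C`, `t` and the modulus of continuity of `θ'`; as `α → ∞` the
right-hand side tends to `2 ε`. -/
theorem norm_polar_direction_le_explicit (h : IsHyperboloidCurve α θ θ' x y)
    (hC : ∀ s ∈ Icc (0 : ℝ) 1, ‖θ' s‖ ≤ C) (hα : C < α) {t ε M : ℝ} (ht : t ∈ Ioc (0 : ℝ) 1)
    (hε : 0 ≤ ε) (hM : 0 ≤ M) (hmod : ∀ s ∈ Icc 0 t, ‖θ' t - θ' s‖ ≤ ε + M * (t - s))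
    {ρ : ℝ} {η : E} (hη : ‖η‖ = 1) (hρ : 0 ≤ ρ) (hx : x t = Real.sinh ρ • η)
    (hy : y t = Real.cosh ρ) :
    ‖α • (η - θ t) + θ' t‖ ≤ 6 * (α / (α - C)) * (α - C)⁻¹ / t ^ 2
      + 8 * C ^ 2 * (α / (α - C)) * (α - C)⁻¹ + 2 * C * (α - C)⁻¹ / t
      + 2 * (α / (α - C)) * (ε + (2 * C ^ 2 + M) * (α - C)⁻¹) := by
  have ht' : t ∈ Icc (0 : ℝ) 1 := Ioc_subset_Icc_self ht
  have ht0 : 0 < t := ht.1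
  have hC0 : 0 ≤ C := (norm_nonneg _).trans (hC t ht')
  have hα0 : 0 < α := by linarith
  have hβ := sub_pos.2 hα
  have hy0 : 0 < y t := zero_lt_one.trans_le (h.one_le_time ht')
  have hq0 := zero_lt_one.trans_le (h.one_le_expanding hC hα ht')
  have hqy := h.expanding_le_two_mul_time ht'
  have hqβ := h.mul_le_expanding hC hα ht'
  have htr := h.norm_transverse_le hC hα ht'
  have hpq := h.contracting_mul_expanding ht'
  have hh := h.norm_transverse_add_le hC hα ht' hε hM hmod
  have hp := h.contracting_nonneg ht'
  have hmain := h.norm_polar_direction_le hα0 ht' hη hρ hx hy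
  set β := α - C
  set q := expanding θ x y t
  set p := y t - ⟪θ t, x t⟫
  have hβt : 0 < β * t := mul_pos hβ ht0
  have hyinv : α / y t ≤ 2 * α / q := by
    rw [div_le_div_iff₀ hy0 hq0]; nlinarith
  have hsq : 1 / q ^ 2 ≤ 1 / (β * t) ^ 2 := by gcongr
  have b1 : α / y t ^ 2 ≤ 4 * α * (1 / (β * t) ^ 2) := by
    refine le_trans ?_ (mul_le_mul_of_nonneg_left hsq (by positivity))
    rw [mul_one_div, div_le_div_iff₀ (by positivity) (by positivity)]
    nlinarith [mul_le_mul hqy hqy hq0.le (by positivity)]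
  have b2 : α / y t * ‖transverse θ x t + (y t / α) • θ' t‖
      ≤ 2 * C / (β * t) + 2 * α / β * (ε + (2 * C ^ 2 + M) / β) := by
    calc _ ≤ 2 * α / q * (C / α + (ε + (2 * C ^ 2 + M) / β) / β * q) := by gcongr
      _ = 2 * C / q + 2 * α / β * (ε + (2 * C ^ 2 + M) / β) := by field_simp
      _ ≤ _ := by gcongr
  have b3 : α / y t * p ≤ 2 * α * (1 / (β * t) ^ 2) + 8 * C ^ 2 * α / β ^ 2 := by
    have hpe : p = (1 + ‖transverse θ x t‖ ^ 2) / q := by rw [eq_div_iff hq0.ne', hpq]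
    calc α / y t * p ≤ 2 * α / q * ((1 + (2 * C / β * q) ^ 2) / q) := by
          rw [hpe]; gcongr
      _ = 2 * α * (1 / q ^ 2) + 8 * C ^ 2 * α / β ^ 2 := by field_simp; ring
      _ ≤ _ := by gcongr
  calc _ ≤ _ := hmain
    _ ≤ _ := add_le_add (add_le_add b1 b2) b3
    _ = _ := by field_simp; ring

end IsHyperboloidCurve

/-- For every `ε > 0`, the modulus of continuity at `t` of a bounded continuous function on `[0, t]`
has an affine majorant `ε + M (t - s)`: near `t` the constant `ε` suffices, and elsewhere the bound
of the function does. -/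
theorem exists_affine_modulus {E : Type*} [NormedAddCommGroup E] {g : ℝ → E} {C t ε : ℝ}
    (hC : ∀ s ∈ Icc 0 t, ‖g s‖ ≤ C) (hC0 : 0 ≤ C) (hg : ContinuousOn g (Icc 0 t)) (ht : 0 ≤ t)
    (hε : 0 < ε) :
    ∃ M, 0 ≤ M ∧ ∀ s ∈ Icc 0 t, ‖g t - g s‖ ≤ ε + M * (t - s) := by
  have htt : t ∈ Icc 0 t := ⟨ht, le_rfl⟩
  obtain ⟨δ, hδ, hδε⟩ := Metric.continuousOn_iff.1 hg t htt ε hε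
  refine ⟨2 * C / δ, by positivity, fun s hs => ?_⟩
  have hts : 0 ≤ t - s := sub_nonneg.2 hs.2
  by_cases hsδ : t - s < δ
  · have h1 := hδε s hs (by rwa [dist_comm, Real.dist_eq, abs_of_nonneg hts])
    rw [dist_comm, dist_eq_norm] at h1
    have : 0 ≤ 2 * C / δ * (t - s) := by positivity
    linarith
  · have h1 : ‖g t - g s‖ ≤ 2 * C := (norm_sub_le _ _).trans (by linarith [hC s hs, hC t htt])
    have h2 : 2 * C ≤ 2 * C / δ * (t - s) := by
      rw [div_mul_eq_mul_div, le_div_iff₀ hδ]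
      exact mul_le_mul_of_nonneg_left (not_lt.1 hsδ) (by positivity)
    linarith

/-- As the speed tends to infinity, the polar direction of the development satisfies
`α (η - θ) → -θ'`. -/
theorem tendsto_smul_polar_direction_sub {E κ : Type*} [NormedAddCommGroup E]
    [InnerProductSpace ℝ E] {l : Filter κ} {α : κ → ℝ} (hα : Tendsto α l atTop)
    {θ θ' : ℝ → E} (hθ' : ContinuousOn θ' (Icc 0 1)) {t : ℝ} (ht : t ∈ Ioc (0 : ℝ) 1) {η : κ → E}
    (h : ∀ᶠ k in l, ‖η k‖ = 1 ∧ ∃ x y, IsHyperboloidCurve (α k) θ θ' x y ∧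
      ∃ ρ, 0 ≤ ρ ∧ x t = Real.sinh ρ • η k ∧ y t = Real.cosh ρ) :
    Tendsto (fun k => α k • (η k - θ t)) l (𝓝 (-θ' t)) := by
  obtain ⟨C, hC⟩ := isCompact_Icc.exists_bound_of_continuousOn hθ'
  have ht' : t ∈ Icc (0 : ℝ) 1 := Ioc_subset_Icc_self ht
  have hC0 : 0 ≤ C := (norm_nonneg _).trans (hC t ht')
  have hsub : Icc 0 t ⊆ Icc (0 : ℝ) 1 := Icc_subset_Icc_right ht.2
  rw [Metric.tendsto_nhds]
  intro ε hε
  -- The explicit bound tends to twice the constant of the modulus, so `ε / 4` leaves room.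
  obtain ⟨M, hM, hmod⟩ := exists_affine_modulus (ε := ε / 4) (fun s hs => hC s (hsub hs)) hC0
    (hθ'.mono hsub) ht'.1 (by positivity)
  have hβ : Tendsto (fun k => α k - C) l atTop := tendsto_atTop_add_const_right l (-C) hα
  have hinv : Tendsto (fun k => (α k - C)⁻¹) l (𝓝 0) := tendsto_inv_atTop_zero.comp hβ
  have hratio : Tendsto (fun k => α k / (α k - C)) l (𝓝 1) := by
    have h1 : Tendsto (fun k => 1 + C * (α k - C)⁻¹) l (𝓝 1) := by
      simpa using (hinv.const_mul C).const_add 1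
    refine h1.congr' ?_
    filter_upwards [hβ.eventually_gt_atTop 0] with k hk
    field_simp
    ring
  have hlim : Tendsto (fun k => 6 * (α k / (α k - C)) * (α k - C)⁻¹ / t ^ 2
      + 8 * C ^ 2 * (α k / (α k - C)) * (α k - C)⁻¹ + 2 * C * (α k - C)⁻¹ / t
      + 2 * (α k / (α k - C)) * (ε / 4 + (2 * C ^ 2 + M) * (α k - C)⁻¹)) l (𝓝 (ε / 2)) := by
    have := (((((hratio.const_mul 6).mul hinv).div_const (t ^ 2)).add
      ((hratio.const_mul (8 * C ^ 2)).mul hinv)).add ((hinv.const_mul (2 * C)).div_const t)).add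
      ((hratio.const_mul 2).mul ((hinv.const_mul (2 * C ^ 2 + M)).const_add (ε / 4)))
    convert this using 2
    ring
  filter_upwards [h, hβ.eventually_gt_atTop 0, hlim.eventually_lt_const (half_lt_self hε)]
    with k hk hβk hεk
  obtain ⟨hη, x, y, hxy, ρ, hρ, hx, hy⟩ := hk
  rw [dist_eq_norm, sub_neg_eq_add]
  exact (hxy.norm_polar_direction_le_explicit hC (sub_pos.1 hβk) ht (by positivity) hM hmod
    hη hρ hx hy).trans_lt hεk

/-! ### Cartan developments and their polar coordinates -/

/-- The space-like part of the column `Γ(t) o`. -/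
def spacePart {d : ℕ} (Γ : ℝ → Matrix (Fin d ⊕ Unit) (Fin d ⊕ Unit) ℝ) (t : ℝ) :
    EuclideanSpace ℝ (Fin d) :=
  WithLp.toLp 2 fun i => Γ t (Sum.inl i) (Sum.inr ())

/-- The time-like coordinate of the column `Γ(t) o`. -/
def timePart {d : ℕ} (Γ : ℝ → Matrix (Fin d ⊕ Unit) (Fin d ⊕ Unit) ℝ) (t : ℝ) : ℝ :=
  Γ t (Sum.inr ()) (Sum.inr ())

theorem mulVec_hypBase {d : ℕ} (M : Matrix (Fin d ⊕ Unit) (Fin d ⊕ Unit) ℝ) (i : Fin d ⊕ Unit) :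
    M.mulVec (hypBase d) i = M i (Sum.inr ()) := by
  simp [Matrix.mulVec, dotProduct, hypBase]

theorem mulVec_hypBase_eq_hypPolar_iff {d : ℕ}
    {Γ : ℝ → Matrix (Fin d ⊕ Unit) (Fin d ⊕ Unit) ℝ} {t ρ : ℝ} {η : EuclideanSpace ℝ (Fin d)} :
    (Γ t).mulVec (hypBase d) = hypPolar η ρ ↔
      spacePart Γ t = Real.sinh ρ • η ∧ timePart Γ t = Real.cosh ρ := by
  refine ⟨fun h => ⟨?_, ?_⟩, fun h => ?_⟩
  · ext i
    have := congrFun h (Sum.inl i)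
    rw [mulVec_hypBase] at this
    simpa [hypPolar, spacePart, mul_comm] using this
  · simpa [mulVec_hypBase, hypPolar, timePart] using congrFun h (Sum.inr ())
  · funext i
    rw [mulVec_hypBase]
    rcases i with i | i
    · have := congrArg (fun z : EuclideanSpace ℝ (Fin d) => z i) h.1
      simpa [hypPolar, spacePart, mul_comm] using this
    · exact h.2

theorem IsCartanDevelopment.isHyperboloidCurve {d : ℕ} {γ θ θ' : ℝ → EuclideanSpace ℝ (Fin d)}
    {α : ℝ} {Γ : ℝ → Matrix (Fin d ⊕ Unit) (Fin d ⊕ Unit) ℝ} (hΓ : IsCartanDevelopment γ Γ)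
    (hγ : ∀ t ∈ Icc (0 : ℝ) 1, HasDerivWithinAt γ (α • θ t) (Icc 0 1) t)
    (hθ : ∀ t ∈ Icc (0 : ℝ) 1, HasDerivWithinAt θ (θ' t) (Icc 0 1) t)
    (hθ_norm : ∀ t ∈ Icc (0 : ℝ) 1, ‖θ t‖ = 1) :
    IsHyperboloidCurve α θ θ' (spacePart Γ) (timePart Γ) := by
  have hder : ∀ t ∈ Icc (0 : ℝ) 1, derivWithin γ (Icc 0 1) t = α • θ t := fun t ht =>
    (hγ t ht).derivWithin (uniqueDiffOn_Icc zero_lt_one t ht)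
  refine ⟨hθ, hθ_norm, fun t ht => ?_, fun t ht => ?_, ?_, ?_⟩
  · have h : HasDerivWithinAt (fun v i => Γ v (Sum.inl i) (Sum.inr ()))
        (fun i => (α * timePart Γ t) * θ t i) (Icc 0 1) t := by
      refine hasDerivWithinAt_pi.2 fun i => ?_
      refine (hΓ.ode t ht (Sum.inl i) (Sum.inr ())).congr_deriv ?_
      simp [hder t ht, hypGen, Matrix.mul_apply, timePart]
      ring
    exact (PiLp.continuousLinearEquiv 2 ℝ (fun _ : Fin d => ℝ)).symm.hasFDerivAt
      |>.comp_hasDerivWithinAt t h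
  · refine (hΓ.ode t ht (Sum.inr ()) (Sum.inr ())).congr_deriv ?_
    simp [hder t ht, hypGen, Matrix.mul_apply, spacePart, PiLp.inner_apply, Finset.mul_sum]
    exact Finset.sum_congr rfl fun _ _ => by ring
  · ext i
    simp [spacePart, hΓ.init]
  · simp [timePart, hΓ.init]

/-- Solving the linear equation column by column produces the Cartan development. -/
theorem exists_isCartanDevelopment {d : ℕ} {γ γ' : ℝ → EuclideanSpace ℝ (Fin d)}
    (hγ : ∀ t ∈ Icc (0 : ℝ) 1, HasDerivWithinAt γ (γ' t) (Icc 0 1) t)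
    (hγ' : ContinuousOn γ' (Icc 0 1)) : ∃ Γ, IsCartanDevelopment γ Γ := by
  have hA : ContinuousOn (fun t => (Matrix.mulVecLin (hypGen (γ' t))).toContinuousLinearMap)
      (Icc 0 1) := by
    have hgen : Continuous fun v : EuclideanSpace ℝ (Fin d) =>
        (Matrix.mulVecLin (hypGen v)).toContinuousLinearMap := by
      let T : EuclideanSpace ℝ (Fin d) →ₗ[ℝ] ((Fin d ⊕ Unit → ℝ) →L[ℝ] (Fin d ⊕ Unit → ℝ)) :=
        { toFun := fun v => (Matrix.mulVecLin (hypGen v)).toContinuousLinearMap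
          map_add' := fun v w => by
            have : hypGen (v + w) = hypGen v + hypGen w := by
              rw [hypGen, hypGen, hypGen, Matrix.fromBlocks_add]; simp
            rw [this, Matrix.mulVecLin_add, map_add]
          map_smul' := fun c v => by
            have : hypGen (c • v) = c • hypGen v := by
              rw [hypGen, hypGen, Matrix.fromBlocks_smul]; simp
            ext w i
            simp [this] }
      exact T.continuous_of_finiteDimensional
    exact hgen.comp_continuousOn hγ'
  choose Z hZ0 hZ using fun j : Fin d ⊕ Unit =>
    exists_linear_ode_solution hA (fun i => (1 : Matrix _ _ ℝ) i j)
  refine ⟨fun t => Matrix.of fun i j => Z j t i,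
    fun t ht => (hγ t ht).differentiableWithinAt, ?_, fun t ht i j => ?_⟩
  · ext i j
    simp [hZ0]
  · refine (hasDerivWithinAt_pi.1 (hZ j t ht) i).congr_deriv ?_
    rw [(hγ t ht).derivWithin (uniqueDiffOn_Icc zero_lt_one t ht)]
    simp [Matrix.mulVec, dotProduct, Matrix.mul_apply]

/-- Every point of the upper sheet of the hyperboloid has polar coordinates. -/
theorem exists_polar {E : Type*} [NormedAddCommGroup E] [NormedSpace ℝ E] {x e : E} {y : ℝ}
    (he : ‖e‖ = 1) (hy : 1 ≤ y) (hxy : y ^ 2 = 1 + ‖x‖ ^ 2) :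
    ∃ (η : E) (ρ : ℝ), ‖η‖ = 1 ∧ 0 ≤ ρ ∧ x = Real.sinh ρ • η ∧ y = Real.cosh ρ := by
  have hcosh : y = Real.cosh (Real.arsinh ‖x‖) := by
    rw [Real.cosh_arsinh, ← hxy, Real.sqrt_sq (by linarith)]
  have hρ : 0 ≤ Real.arsinh ‖x‖ := Real.arsinh_nonneg_iff.2 (norm_nonneg x)
  by_cases hx : x = 0
  · exact ⟨e, Real.arsinh ‖x‖, he, hρ, by simp [hx], hcosh⟩
  · have hx0 : ‖x‖ ≠ 0 := norm_ne_zero_iff.2 hx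
    refine ⟨‖x‖⁻¹ • x, Real.arsinh ‖x‖, ?_, hρ, ?_, hcosh⟩
    · rw [norm_smul, norm_inv, norm_norm, inv_mul_cancel₀ hx0]
    · rw [Real.sinh_arsinh, smul_smul, mul_inv_cancel₀ hx0, one_smul]

/-- For a unit vector `u`, the matrix `I + u uᵀ` fixes the orthogonal complement of `u`. -/
theorem one_add_vecMulVec_inv_mulVec {d : ℕ} {u v : EuclideanSpace ℝ (Fin d)} (hu : ‖u‖ = 1)
    (huv : ⟪u, v⟫ = 0) :
    (1 + Matrix.vecMulVec u.ofLp u.ofLp)⁻¹.mulVec v.ofLp = v.ofLp := by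
  have huu : u.ofLp ⬝ᵥ u.ofLp = 1 := by
    have : ⟪u, u⟫ = 1 := by rw [real_inner_self_eq_norm_sq, hu, one_pow]
    rw [PiLp.inner_apply] at this
    simpa only [dotProduct, RCLike.inner_apply, conj_trivial] using this
  have huv' : u.ofLp ⬝ᵥ v.ofLp = 0 := by
    simpa [PiLp.inner_apply, dotProduct, mul_comm] using huv
  -- The inverse is `I - u uᵀ / 2`.
  have hinv : (1 + Matrix.vecMulVec u.ofLp u.ofLp) *
      (1 - (2⁻¹ : ℝ) • Matrix.vecMulVec u.ofLp u.ofLp) = 1 := by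
    rw [add_mul, mul_sub, mul_sub, Matrix.mul_smul, Matrix.mul_smul,
      Matrix.vecMulVec_mul_vecMulVec, huu]
    simp
    module
  rw [Matrix.inv_eq_right_inv hinv, Matrix.sub_mulVec, Matrix.smul_mulVec, Matrix.one_mulVec,
    Matrix.vecMulVec_mulVec, huv']
  simp

theorem mainTheorem3 (d : ℕ) (L : ℝ) (hL : 0 < L)
    (γ θ : ℝ → EuclideanSpace ℝ (Fin d))
    (hθ : ContDiffOn ℝ 1 θ (Set.Icc 0 1))
    (hθ_sphere : ∀ t ∈ Set.Icc (0 : ℝ) 1, θ t ∈ Metric.sphere (0 : EuclideanSpace ℝ (Fin d)) 1)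
    (hγ : ∀ t ∈ Set.Icc (0 : ℝ) 1, HasDerivWithinAt γ (L • θ t) (Set.Icc 0 1) t) :
    (∀ lam : ℝ, 0 < lam → ∃ (η : ℝ → EuclideanSpace ℝ (Fin d)) (ρ : ℝ → ℝ),
      IsHyperbolicDevelopment (fun t => lam • γ t) η ρ) ∧
    ∀ (η : ℝ → ℝ → EuclideanSpace ℝ (Fin d)) (ρ : ℝ → ℝ → ℝ),
      (∀ lam : ℝ, 0 < lam → IsHyperbolicDevelopment (fun t => lam • γ t) (η lam) (ρ lam)) →
      (∀ t ∈ Set.Ioc (0 : ℝ) 1,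
        Filter.Tendsto (fun lam : ℝ => (lam * L) • (η lam t - θ t)) Filter.atTop
          (nhds (-WithLp.toLp 2
            (Matrix.mulVec (1 + Matrix.vecMulVec (θ t).ofLp (θ t).ofLp)⁻¹
              (derivWithin θ (Set.Icc 0 1) t).ofLp)))) ∧
      Filter.Tendsto (fun lam : ℝ => η lam 1) Filter.atTop (nhds (θ 1)) := by
  have hnorm : ∀ t ∈ Icc (0 : ℝ) 1, ‖θ t‖ = 1 := fun t ht =>
    mem_sphere_zero_iff_norm.1 (hθ_sphere t ht)
  have hθd : ∀ t ∈ Icc (0 : ℝ) 1,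
      HasDerivWithinAt θ (derivWithin θ (Icc 0 1) t) (Icc 0 1) t := fun t ht =>
    (hθ.differentiableOn one_ne_zero t ht).hasDerivWithinAt
  have hθ' : ContinuousOn (derivWithin θ (Icc 0 1)) (Icc 0 1) :=
    hθ.continuousOn_derivWithin (uniqueDiffOn_Icc zero_lt_one) le_rfl
  have hγlam : ∀ lam : ℝ, ∀ t ∈ Icc (0 : ℝ) 1,
      HasDerivWithinAt (fun t => lam • γ t) ((lam * L) • θ t) (Icc 0 1) t := fun lam t ht =>
    ((hγ t ht).const_smul lam).congr_deriv (smul_smul lam L (θ t))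
  refine ⟨fun lam _ => ?_, fun η ρ hdev => ?_⟩
  · obtain ⟨Γ, hΓ⟩ := exists_isCartanDevelopment (hγlam lam)
      (show ContinuousOn (fun t => (lam * L) • θ t) (Icc 0 1) from
        hθ.continuousOn.const_smul (lam * L))
    have hcurve := hΓ.isHyperboloidCurve (hγlam lam) hθd hnorm
    choose! η ρ hη using fun t (ht : t ∈ Icc (0 : ℝ) 1) =>
      exists_polar (hnorm t ht) (hcurve.one_le_time ht) (hcurve.time_sq ht)
    refine ⟨η, ρ, Γ, hΓ, fun t ht => ?_⟩
    obtain ⟨h1, h2, h3⟩ := hη t ht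
    exact ⟨h1, h2, mulVec_hypBase_eq_hypPolar_iff.2 h3⟩
  · have hspeed : Tendsto (fun lam : ℝ => lam * L) atTop atTop := tendsto_id.atTop_mul_const hL
    have hlim : ∀ t ∈ Ioc (0 : ℝ) 1, Tendsto (fun lam : ℝ => (lam * L) • (η lam t - θ t)) atTop
        (𝓝 (-derivWithin θ (Icc 0 1) t)) := by
      intro t ht
      refine tendsto_smul_polar_direction_sub hspeed hθ' ht ?_
      filter_upwards [eventually_gt_atTop 0] with lam hlam
      obtain ⟨Γ, hΓ, hpolar⟩ := hdev lam hlam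
      obtain ⟨h1, h2, h3⟩ := hpolar t (Ioc_subset_Icc_self ht)
      exact ⟨h1, _, _, hΓ.isHyperboloidCurve (hγlam lam) hθd hnorm, ρ lam t, h2,
        mulVec_hypBase_eq_hypPolar_iff.1 h3⟩
    refine ⟨fun t ht => ?_, ?_⟩
    · have ht' := Ioc_subset_Icc_self ht
      obtain ⟨Γ, hΓ, -⟩ := hdev 1 one_pos
      rw [one_add_vecMulVec_inv_mulVec (hnorm t ht')
        ((hΓ.isHyperboloidCurve (hγlam 1) hθd hnorm).inner_deriv_transverse ht').1]
      exact hlim t ht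
    · have h0 := (tendsto_inv_atTop_zero.comp hspeed).smul (hlim 1 (by simp))
      rw [zero_smul] at h0
      rw [← tendsto_sub_nhds_zero_iff]
      refine h0.congr' ?_
      filter_upwards [hspeed.eventually_gt_atTop 0] with lam hlam
      rw [Function.comp_apply, smul_smul, inv_mul_cancel₀ hlam.ne', one_smul]
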